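/- Let $\mathcal H=L^2(\mathbb R^2;\mathbb C^2)$ with operator norm $\|\cdot\|$, let $D=\frac1i\nabla$ and $D\cdot\sigma=D_1\sigma_1+D_2\sigma_2$ with $\sigma_1=\begin{pmatrix}0&1\\1&0\end{pmatrix}$, $\sigma_2=\begin{pmatrix}0&-i\\i&0\end{pmatrix}$ (self-adjoint on $H^1(\mathbb R^2;\mathbb C^2)$), let $B$ be a bounded operator on $\mathcal H$ and $\varepsilon>0$. Let $U(\tau)$ be the evolution operator of $$H(\tau)=D\cdot\sigma+\varepsilon\,(Be^{-i\tau}+B^*e^{i\tau}),$$ that is, $i\partial_\tau U(\tau)=H(\tau)U(\tau)$ on the domain of $D\cdot\sigma$ and $U(0)=I$. For $n\ge 0$ let $S_n=\{-n,\dots,n\}$ and let $\widehat H_n$ be the self-adjoint operator on $L^2(\mathbb R^2;S_n\otimes\mathbb C^2)$ given by $$[\widehat H_n\varphi]_m=(m+D\cdot\sigma)\varphi_m+\varepsilon B\varphi_{m+1}+\varepsilon B^*\varphi_{m-1},\qquad m\in S_n,$$ with $\varphi_\ell:=0$ for $\ell\notin S_n$ (the $(2n+1)$-replica model). Put $U_n(\tau)=\sum_{k\in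 S_n}[e^{-i\tau\widehat H_n}]_{0k}$, where $[O]_{jk}$ denotes the $(j,k)$ block $\mathcal H\to\mathcal H$ of $O$, and, for $\tau=2\pi N+\tau'$ with $N\in\{0,1,2,\dots\}$ and $0\le\tau'<2\pi$, put $U_n'(\tau)=U_n(\tau')[U_n(2\pi)]^N$. Then, with $c_n=\dfrac{2(4\pi\|B\|)^{n+1}}{2\pi\,(n+1)!}$, for all $\tau\ge 0$, $$\|U(\tau)-U_n'(\tau)\|\le c_n(\tau+1)\,\varepsilon^{n+1}e^{c_n\tau\varepsilon^{n+1}}.$$ Consequently $U_n'$ captures $U$ up to times of order $\varepsilon^{-(n+1)}$, in the following sense: for every $n\ge0$, every $b$ and every $\eta>0$ there are $\kappa>0$ and $\varepsilon_0>0$ such that, for all $0<\varepsilon\le\varepsilon_0$, all bounded $B$ (which may depend on $\varepsilon$) with $\|B\|\le b$ and all $0\le\tau\le\kappa\,\varepsilon^{-(n+1)}$, one has $\|U(\tau)-U_n'(\tau)\|\le\eta$. -/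

import Mathlib

open MeasureTheory
open scoped FourierTransform

noncomputable section

/-- The Hilbert space `L²(ℝ²; ℂ²)` of electronic states. -/
abbrev ElectronSpace : Type :=
  Lp (EuclideanSpace ℂ (Fin 2)) 2 (volume : Measure (EuclideanSpace ℝ (Fin 2)))

/-- The first Pauli matrix. -/
def pauli1 : Matrix (Fin 2) (Fin 2) ℂ := !![0, 1; 1, 0]

/-- The second Pauli matrix. -/
def pauli2 : Matrix (Fin 2) (Fin 2) ℂ := !![0, -Complex.I; Complex.I, 0]

/-- The Fourier symbol of `D · σ = D₁ σ₁ + D₂ σ₂`, where `D = (1/i) ∇`. The Fourier transform of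
Mathlib is `(𝓕 f) ξ = ∫ exp (-2 π i x · ξ) f x`, so that `D_j` becomes multiplication
by `2 π ξ_j`. -/
def diracSymbol (ξ : EuclideanSpace ℝ (Fin 2)) : Matrix (Fin 2) (Fin 2) ℂ :=
  ((2 * Real.pi * ξ 0 : ℝ) : ℂ) • pauli1 + ((2 * Real.pi * ξ 1 : ℝ) : ℂ) • pauli2

/-- The graph of `D · σ`: pairs `(ψ, φ)` of `L²` functions whose Fourier transforms satisfy
`(𝓕 φ) ξ = (2 π ξ · σ) (𝓕 ψ) ξ` for almost every `ξ`. -/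
def diracGraph : Submodule ℂ (ElectronSpace × ElectronSpace) where
  carrier := {p | ∀ᵐ ξ ∂(volume : Measure (EuclideanSpace ℝ (Fin 2))),
    (𝓕 p.2 : ElectronSpace) ξ
      = Matrix.toEuclideanCLM (𝕜 := ℂ) (diracSymbol ξ) ((𝓕 p.1 : ElectronSpace) ξ)}
  zero_mem' := by
    have h0 : (𝓕 (0 : ElectronSpace) : ElectronSpace) = 0 :=
      (Lp.fourierTransformₗᵢ _ _).map_zero
    simp only [Set.mem_ofPred_eq, Prod.fst_zero, Prod.snd_zero, h0]
    filter_upwards with ξ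
    simp
  add_mem' := by
    intro p q hp hq
    simp only [Set.mem_ofPred_eq, Prod.fst_add, Prod.snd_add, FourierTransform.fourier_add]
      at hp hq ⊢
    filter_upwards [hp, hq, Lp.coeFn_add (𝓕 p.1 : ElectronSpace) (𝓕 q.1 : ElectronSpace),
      Lp.coeFn_add (𝓕 p.2 : ElectronSpace) (𝓕 q.2 : ElectronSpace)] with ξ h1 h2 h3 h4
    rw [h3, h4, Pi.add_apply, Pi.add_apply, h1, h2, map_add]
  smul_mem' := by
    intro c p hp
    simp only [Set.mem_ofPred_eq, Prod.smul_fst, Prod.smul_snd, FourierTransform.fourier_smul]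
      at hp ⊢
    filter_upwards [hp, Lp.coeFn_smul c (𝓕 p.1 : ElectronSpace),
      Lp.coeFn_smul c (𝓕 p.2 : ElectronSpace)] with ξ h1 h2 h3
    rw [h2, h3, Pi.smul_apply, Pi.smul_apply, h1, map_smul]

/-- The free Dirac operator `D · σ` on `L²(ℝ²; ℂ²)`, an unbounded operator whose domain consists of
all `ψ` with `D · σ ψ ∈ L²` (this is the Sobolev space `H¹`). -/
def diracOperator : ElectronSpace →ₗ.[ℂ] ElectronSpace := diracGraph.toLinearPMap

/-- The relation `diracGraph` is the graph of a function, so `diracOperator` has this graph. -/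
theorem diracOperator_graph : diracOperator.graph = diracGraph := by
  refine Submodule.toLinearPMap_graph_eq _ ?_
  rintro ⟨ψ, φ⟩ h (h0 : ψ = 0)
  subst h0
  have h0 : (𝓕 (0 : ElectronSpace) : ElectronSpace) = 0 :=
    (Lp.fourierTransformₗᵢ _ _).map_zero
  have h1 : (𝓕 φ : ElectronSpace) = 0 := by
    refine Lp.ext ?_
    have h' : ∀ᵐ ξ ∂(volume : Measure (EuclideanSpace ℝ (Fin 2))), (𝓕 φ : ElectronSpace) ξ
      = Matrix.toEuclideanCLM (𝕜 := ℂ) (diracSymbol ξ)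
        ((𝓕 (0 : ElectronSpace) : ElectronSpace) ξ) := h
    rw [h0] at h'
    filter_upwards [h', Lp.coeFn_zero (EuclideanSpace ℂ (Fin 2)) 2
      (volume : Measure (EuclideanSpace ℝ (Fin 2)))] with ξ h2 h3
    rw [h2, h3]
    simp
  exact (Lp.fourierTransformₗᵢ _ _).injective (h1.trans h0.symm)

/-- The `2π`-periodic Hamiltonian `H(τ) = D · σ + ε (B e^{-iτ} + B^* e^{iτ})`, with domain that
of `D · σ`. -/
def drivenHamiltonian (B : ElectronSpace →L[ℂ] ElectronSpace) (ε τ : ℝ) :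
    ElectronSpace →ₗ.[ℂ] ElectronSpace where
  domain := diracOperator.domain
  toFun := diracOperator.toFun +
    ((ε : ℂ) • (Complex.exp (-(Complex.I * τ)) • B
      + Complex.exp (Complex.I * τ) • ContinuousLinearMap.adjoint B)).toLinearMap ∘ₗ
        diracOperator.domain.subtype

/-- `U` is the time evolution operator of the Hamiltonians `H τ`:
`i ∂_τ U(τ) = H(τ) U(τ)` on the domain and `U(0) = I`. -/
def IsEvolutionOperator {E : Type*} [NormedAddCommGroup E] [InnerProductSpace ℂ E]
    (H : ℝ → E →ₗ.[ℂ] E) (U : ℝ → E →L[ℂ] E) : Prop :=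
  U 0 = 1 ∧ ∀ ψ ∈ (H 0).domain, ∀ τ : ℝ, ∃ h : U τ ψ ∈ (H τ).domain,
    HasDerivAt (fun s => U s ψ) (-Complex.I • H τ ⟨U τ ψ, h⟩) τ

/-- `T` is the unitary group `T(τ) = e^{-iτA}` of the (self-adjoint, possibly unbounded)
operator `A`: a strongly continuous one-parameter group of unitary operators whose derivative
at `0` exists exactly on the domain of `A` and equals `-iA` there. -/
structure IsUnitaryGroup {E : Type*} [NormedAddCommGroup E] [InnerProductSpace ℂ E]
    [CompleteSpace E] (A : E →ₗ.[ℂ] E) (T : ℝ → E →L[ℂ] E) : Prop where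
  zero : T 0 = 1
  add : ∀ s t, T (s + t) = T s * T t
  unitary : ∀ t, T t ∈ unitary (E →L[ℂ] E)
  continuous : ∀ ψ, Continuous fun t => T t ψ
  generator : ∀ ψ φ, (ψ, φ) ∈ A.graph ↔ HasDerivAt (fun t => T t ψ) (-Complex.I • φ) 0

/-- The space `L²(ℝ²; S ⊗ ℂ²)`, as the Hilbert sum of copies of `L²(ℝ²; ℂ²)` indexed by the
finite set `S` of Fourier modes. -/
abbrev ReplicaSpace (S : Finset ℤ) : Type := PiLp 2 fun _ : S => ElectronSpace

/-- The `m`-th Fourier mode, `m ∈ ℤ`, of the embedding of `Φ ∈ L²(ℝ²; S ⊗ ℂ²)` into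
`L²(ℝ²; ℤ ⊗ ℂ²)`: it is `Φ_m` for `m ∈ S` and `0` otherwise. -/
def replicaMode (S : Finset ℤ) (m : ℤ) : ReplicaSpace S →L[ℂ] ElectronSpace :=
  if h : m ∈ S then PiLp.proj 2 (fun _ : S => ElectronSpace) ⟨m, h⟩ else 0

/-- The replica model on the modes in `S`: the compression to `L²(ℝ²; S ⊗ ℂ²)` of
`[Ĥ φ]_m = (m + D · σ) φ_m + ε B φ_{m+1} + ε B^* φ_{m-1}`, `m ∈ ℤ`. Its domain consists of
the `Φ` all of whose modes lie in the domain of `D · σ`. -/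
def replicaHamiltonian (B : ElectronSpace →L[ℂ] ElectronSpace) (ε : ℝ) (S : Finset ℤ) :
    ReplicaSpace S →ₗ.[ℂ] ReplicaSpace S where
  domain :=
    { carrier := {Φ | ∀ m : S, Φ m ∈ diracOperator.domain}
      zero_mem' := fun _ => diracOperator.domain.zero_mem
      add_mem' := fun ha hb m => diracOperator.domain.add_mem (ha m) (hb m)
      smul_mem' := fun c _ ha m => diracOperator.domain.smul_mem c (ha m) }
  toFun :=
    { toFun := fun Φ => WithLp.toLp 2 fun m : S =>
        (((m : ℤ) : ℂ) • Φ.1 m + diracOperator ⟨Φ.1 m, Φ.2 m⟩)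
          + (ε : ℂ) • B (replicaMode S (m + 1) Φ.1)
          + (ε : ℂ) • ContinuousLinearMap.adjoint B (replicaMode S (m - 1) Φ.1)
      map_add' := by
        intro Φ Ψ
        ext1 m
        have h := diracOperator.map_add ⟨Φ.1 m, Φ.2 m⟩ ⟨Ψ.1 m, Ψ.2 m⟩
        have h' : diracOperator ⟨(Φ + Ψ).1 m, (Φ + Ψ).2 m⟩
            = diracOperator (⟨Φ.1 m, Φ.2 m⟩ + ⟨Ψ.1 m, Ψ.2 m⟩) := rfl
        simp only [PiLp.add_apply]
        rw [h', h]
        simp only [Submodule.coe_add, PiLp.add_apply, map_add, smul_add]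
        abel
      map_smul' := by
        intro c Φ
        ext1 m
        have h := diracOperator.map_smul c ⟨Φ.1 m, Φ.2 m⟩
        have h' : diracOperator ⟨(c • Φ).1 m, (c • Φ).2 m⟩
            = diracOperator (c • ⟨Φ.1 m, Φ.2 m⟩) := rfl
        simp only [PiLp.smul_apply, RingHom.id_apply]
        rw [h', h]
        simp only [Submodule.coe_smul, PiLp.smul_apply, map_smul, smul_add,
          smul_comm c] }

/-- The set of modes `S_n = {-n, …, n}`. -/
def modeSet (n : ℕ) : Finset ℤ := Finset.Icc (-(n : ℤ)) n

/-- The central mode `0`, an element of `S_n`. -/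
def centralMode (n : ℕ) : modeSet n := ⟨0, by simp [modeSet]⟩

/-- The block `[O]_{jk}` of an operator `O` on the replica space: `[O]_{jk} ψ = [O (e_k ⊗ ψ)]_j`. -/
def replicaBlock {S : Finset ℤ} (O : ReplicaSpace S →L[ℂ] ReplicaSpace S) (j k : S) :
    ElectronSpace →L[ℂ] ElectronSpace :=
  PiLp.proj 2 (fun _ : S => ElectronSpace) j ∘L O ∘L
    (PiLp.continuousLinearEquiv 2 ℂ fun _ : S => ElectronSpace).symm.toContinuousLinearMap ∘L
      ContinuousLinearMap.single ℂ (fun _ : S => ElectronSpace) k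

/-- The approximate evolution `U_n(τ) = ∑_{k ∈ S_n} [T(τ)]_{0k}` read off from the group
`T(τ) = e^{-iτĤ_n}` of the replica model. -/
def replicaEvolution {n : ℕ}
    (T : ℝ → ReplicaSpace (modeSet n) →L[ℂ] ReplicaSpace (modeSet n)) (τ : ℝ) :
    ElectronSpace →L[ℂ] ElectronSpace :=
  ∑ k : modeSet n, replicaBlock (T τ) (centralMode n) k

/-- The extension `V'(τ) = V(τ') V(2π)^N` for `τ = 2πN + τ'`, `N ∈ ℕ`, `0 ≤ τ' < 2π` (used for
`τ ≥ 0` only). -/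
def periodicExtension (V : ℝ → ElectronSpace →L[ℂ] ElectronSpace) (τ : ℝ) :
    ElectronSpace →L[ℂ] ElectronSpace :=
  V (τ - 2 * Real.pi * ⌊τ / (2 * Real.pi)⌋₊) * V (2 * Real.pi) ^ ⌊τ / (2 * Real.pi)⌋₊

/-- The constant `c_n = 2 (4π b)^{n+1} / (2π (n+1)!)`, where `b` stands for the norm of `B`. -/
def replicaConstant (n : ℕ) (b : ℝ) : ℝ :=
  2 * (4 * Real.pi * b) ^ (n + 1) / (2 * Real.pi * Nat.factorial (n + 1))

end

/-! For `ψ` in the domain of `D · σ`, the functions `e^{-imτ} U(τ) ψ`, `m ∈ ℤ`, solve the replica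
equation with all modes retained. The truncated model, started with `ψ` in every mode, has `U_n(τ)
ψ` as its central mode. The difference of the two vanishes at time zero, obeys the same hopping
equation for `|m| ≤ n`, and has norm `‖ψ‖` at `m = ±(n+1)`, where the truncated modes are zero.

The hopping is Hermitian, so the energy of the modes `|m| ≤ M` changes only through the flux across
the two ends. Hence the modes `|m| ≤ M` are bounded by the time integral of `2ε‖B‖` times a bound on
the modes `±(M+1)` (`norm_mode_le_of_boundary_le`). Descending from `M = n` to `M = 0` takes `n+1`
integrations, which produce the power and the factorial in `norm_central_mode_le` and thus the local
error `norm_sub_replicaEvolution_le`.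

Periodicity gives `U(τ + 2πN) = U(τ) U(2π)^N`, and telescoping the difference of powers makes the
local errors over `N` periods add up, the powers of `U_n(2π)` costing only an exponential factor
(`norm_sub_periodicExtension_le`). Density of the domain turns bounds on `ψ` into operator norm
bounds. -/

/-- If `f' ≤ 2 G' √f` and `f` starts at zero, then `√f ≤ G`. -/
theorem le_sq_of_deriv_le_mul_sqrt {f f' G G' : ℝ → ℝ} (hf : ∀ t, HasDerivAt f (f' t) t)
    (hG : ∀ t, HasDerivAt G (G' t) t) (hf0 : f 0 = 0) (hG0 : G 0 = 0)
    (hnn : ∀ t, 0 ≤ f t) (hG' : ∀ t, 0 ≤ t → 0 ≤ G' t)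
    (hle : ∀ t, 0 ≤ t → f' t ≤ 2 * G' t * √(f t)) {t : ℝ} (ht : 0 ≤ t) :
    √(f t) ≤ G t := by
  -- The square root is not differentiable at zero, so `√(f + δ²)` is compared with `δ + G` before
  -- letting `δ → 0`.
  have key : ∀ δ : ℝ, 0 < δ → √(f t) ≤ δ + G t := by
    intro δ hδ
    have hpos : ∀ s, 0 < f s + δ ^ 2 := fun s => by have := hnn s; positivity
    have hd : ∀ s, HasDerivAt (fun s => √(f s + δ ^ 2)) (f' s / (2 * √(f s + δ ^ 2))) s :=
      fun s => ((hf s).add_const (δ ^ 2)).sqrt (hpos s).ne'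
    have h := image_le_of_deriv_right_le_deriv_boundary (a := 0) (b := t)
      (f := fun s => √(f s + δ ^ 2)) (B := fun s => δ + G s)
      (fun s _ => (hd s).continuousAt.continuousWithinAt)
      (fun s _ => (hd s).hasDerivWithinAt)
      (by simp [hf0, hG0, Real.sqrt_sq hδ.le])
      (fun s _ => ((hG s).const_add δ).continuousAt.continuousWithinAt)
      (fun s _ => ((hG s).const_add δ).hasDerivWithinAt)
      (by
        intro s hs
        have h1 : √(f s) ≤ √(f s + δ ^ 2) := Real.sqrt_le_sqrt (by nlinarith)
        have h2 : 0 < √(f s + δ ^ 2) := Real.sqrt_pos.mpr (hpos s)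
        rw [div_le_iff₀ (by positivity)]
        have := mul_le_mul_of_nonneg_left h1 (hG' s hs.1)
        linarith [hle s hs.1])
      (Set.right_mem_Icc.mpr ht)
    exact (Real.sqrt_le_sqrt (by nlinarith)).trans h
  exact le_of_forall_pos_le_add fun δ hδ => by linarith [key δ hδ]

/-! ### Energy and ladder estimates in an abstract Hilbert space -/

section Hilbert

variable {E : Type*} [NormedAddCommGroup E] [InnerProductSpace ℂ E]

theorem hasDerivAt_norm_sq_re {f : ℝ → E} {f' : E} {t : ℝ} (hf : HasDerivAt f f' t) :
    HasDerivAt (fun s => ‖f s‖ ^ 2) (2 * (inner ℂ (f t) f').re) t := by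
  have h := (Complex.reCLM.hasFDerivAt.comp_hasDerivAt t (hf.inner ℂ hf))
  have h1 : (Complex.reCLM : ℂ → ℝ) ∘ (fun s => inner ℂ (f s) (f s)) = fun s => ‖f s‖ ^ 2 := by
    ext s
    rw [Function.comp_apply, inner_self_eq_norm_sq_to_K]
    exact Complex.ofReal_re (‖f s‖ ^ 2) ▸ by norm_cast
  rw [h1] at h
  have h2 : (inner ℂ f' (f t)).re = (inner ℂ (f t) f').re := inner_re_symm (𝕜 := ℂ) _ _
  refine h.congr_deriv ?_
  rw [Complex.reCLM_apply, Complex.add_re, h2, two_mul]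

theorem norm_eq_of_hasDerivAt_of_re_inner_eq_zero {f f' : ℝ → E}
    (hf : ∀ t, HasDerivAt f (f' t) t) (h0 : ∀ t, (inner ℂ (f t) (f' t)).re = 0) (s t : ℝ) :
    ‖f s‖ = ‖f t‖ := by
  have h : ∀ t, HasDerivAt (fun s => ‖f s‖ ^ 2) 0 t := fun t => by
    simpa [h0 t] using hasDerivAt_norm_sq_re (hf t)
  have h2 := is_const_of_deriv_eq_zero (fun t => (h t).differentiableAt) (fun t => (h t).deriv) s t
  exact (sq_eq_sq₀ (norm_nonneg _) (norm_nonneg _)).mp h2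

theorem re_inner_neg_I_smul (x y : E) : (inner ℂ x (-Complex.I • y)).re = (inner ℂ x y).im := by
  simp [inner_smul_right]

theorem sum_Icc_symm_int_telescope (a : ℤ → ℝ) (M : ℕ) :
    ∑ m ∈ Finset.Icc (-(M : ℤ)) M, (a m - a (m - 1)) = a M - a (-(M : ℤ) - 1) := by
  induction M with
  | zero => simp
  | succ M ih =>
    have h : Finset.Icc (-((M + 1 : ℕ) : ℤ)) ((M + 1 : ℕ) : ℤ)
        = insert (-(M : ℤ) - 1) (insert ((M : ℤ) + 1) (Finset.Icc (-(M : ℤ)) M)) := by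
      ext x; simp only [Finset.mem_Icc, Finset.mem_insert]; push_cast; omega
    rw [h, Finset.sum_insert, Finset.sum_insert, ih]
    · have e1 : (M : ℤ) + 1 - 1 = M := by ring
      have e2 : -((M + 1 : ℕ) : ℤ) = -(M : ℤ) - 1 := by push_cast; ring
      rw [e1, e2]; push_cast; ring
    · simp
    · simp only [Finset.mem_Icc, Finset.mem_insert]; omega

variable [CompleteSpace E]

/-- One step of the ladder estimate: for a nearest-neighbour hopping system the modes `|m| ≤ M`
are driven only by the modes `±(M + 1)`. -/
theorem norm_mode_le_of_boundary_le (B : E →L[ℂ] E) {ε : ℝ} (hε : 0 ≤ ε) {φ A : ℤ → ℝ → E}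
    {M : ℕ} (hφ : ∀ m ∈ Finset.Icc (-(M : ℤ)) M, ∀ t, HasDerivAt (φ m)
      (-Complex.I • (A m t + (ε : ℂ) • B (φ (m + 1) t)
        + (ε : ℂ) • ContinuousLinearMap.adjoint B (φ (m - 1) t))) t)
    (hA : ∀ m ∈ Finset.Icc (-(M : ℤ)) M, ∀ t, (inner ℂ (φ m t) (A m t)).im = 0)
    (h0 : ∀ m ∈ Finset.Icc (-(M : ℤ)) M, φ m 0 = 0) {g G : ℝ → ℝ}
    (hG : ∀ t, HasDerivAt G (2 * ε * ‖B‖ * g t) t) (hG0 : G 0 = 0)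
    (hup : ∀ t, 0 ≤ t → ‖φ (M + 1) t‖ ≤ g t) (hdown : ∀ t, 0 ≤ t → ‖φ (-(M : ℤ) - 1) t‖ ≤ g t)
    {m : ℤ} (hm : m ∈ Finset.Icc (-(M : ℤ)) M) {t : ℝ} (ht : 0 ≤ t) : ‖φ m t‖ ≤ G t := by
  set f : ℝ → ℝ := fun t => ∑ m ∈ Finset.Icc (-(M : ℤ)) M, ‖φ m t‖ ^ 2 with hf
  have hle : ∀ k ∈ Finset.Icc (-(M : ℤ)) M, ∀ t, ‖φ k t‖ ≤ √(f t) := fun k hk t =>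
    Real.le_sqrt_of_sq_le (Finset.single_le_sum (f := fun m => ‖φ m t‖ ^ 2)
      (fun i _ => by positivity) hk)
  -- `a m` is half the rate of energy flow across the bond from `m + 1` to `m`. By the adjoint
  -- relation the `B^*` term at mode `m` contributes `-a (m - 1)`, so the sum telescopes.
  set a : ℤ → ℝ → ℝ := fun m t => ε * (inner ℂ (φ m t) (B (φ (m + 1) t))).im with ha
  have hd : ∀ t, HasDerivAt f (2 * (a M t - a (-(M : ℤ) - 1) t)) t := by
    intro t
    have h := HasDerivAt.fun_sum fun m hm => hasDerivAt_norm_sq_re (hφ m hm t)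
    refine h.congr_deriv ?_
    rw [← Finset.mul_sum, ← sum_Icc_symm_int_telescope (fun m => a m t)]
    congr 1
    refine Finset.sum_congr rfl fun m hm => ?_
    rw [re_inner_neg_I_smul, inner_add_right, inner_add_right, inner_smul_right, inner_smul_right,
      ContinuousLinearMap.adjoint_inner_right]
    have e : (inner ℂ (B (φ m t)) (φ (m - 1) t)).im
        = -(inner ℂ (φ (m - 1) t) (B (φ m t))).im := by
      rw [← inner_conj_symm, Complex.conj_im]
    simp [hA m hm t, ha, e, ← sub_eq_add_neg]
  have hbd : ∀ k l t, |(inner ℂ (φ k t) (B (φ l t))).im| ≤ ‖φ k t‖ * (‖B‖ * ‖φ l t‖) :=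
    fun k l t => (Complex.abs_im_le_norm _).trans <| (norm_inner_le_norm _ _).trans <| by
      gcongr; exact B.le_opNorm _
  refine (hle m hm t).trans (le_sq_of_deriv_le_mul_sqrt hd hG ?_ hG0
    (fun t => Finset.sum_nonneg fun i _ => by positivity) ?_ ?_ ht)
  · exact Finset.sum_eq_zero fun m hm => by simp [h0 m hm]
  · intro t ht
    have := (norm_nonneg _).trans (hup t ht)
    positivity
  · intro t ht
    have hg := (norm_nonneg _).trans (hup t ht)
    have h1 : a M t ≤ ε * (√(f t) * (‖B‖ * g t)) := by
      refine mul_le_mul_of_nonneg_left ((le_abs_self _).trans ((hbd _ _ t).trans ?_)) hε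
      gcongr
      · exact hle _ (by simp) t
      · exact hup t ht
    have h2 : -a (-(M : ℤ) - 1) t ≤ ε * (g t * (‖B‖ * √(f t))) := by
      rw [ha, ← mul_neg]
      refine mul_le_mul_of_nonneg_left ((neg_le_abs _).trans ((hbd _ _ t).trans ?_)) hε
      gcongr
      · exact hdown t ht
      · exact hle _ (by simp) t
    linarith

/-- The ladder estimate: a nearest-neighbour hopping system starting from zero and forced at the
modes `±(n + 1)` reaches the mode `0` only at order `n + 1`. -/
theorem norm_central_mode_le (B : E →L[ℂ] E) {ε : ℝ} (hε : 0 ≤ ε) {φ A : ℤ → ℝ → E}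
    {n : ℕ} (hφ : ∀ m ∈ Finset.Icc (-(n : ℤ)) n, ∀ t, HasDerivAt (φ m)
      (-Complex.I • (A m t + (ε : ℂ) • B (φ (m + 1) t)
        + (ε : ℂ) • ContinuousLinearMap.adjoint B (φ (m - 1) t))) t)
    (hA : ∀ m ∈ Finset.Icc (-(n : ℤ)) n, ∀ t, (inner ℂ (φ m t) (A m t)).im = 0)
    (h0 : ∀ m ∈ Finset.Icc (-(n : ℤ)) n, φ m 0 = 0) {K : ℝ}
    (hup : ∀ t, ‖φ (n + 1) t‖ ≤ K) (hdown : ∀ t, ‖φ (-(n : ℤ) - 1) t‖ ≤ K)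
    {t : ℝ} (ht : 0 ≤ t) :
    ‖φ 0 t‖ ≤ K * (2 * ε * ‖B‖ * t) ^ (n + 1) / (n + 1).factorial := by
  -- The window shrinks by one mode on each side as `j` grows: the modes `±(M + 1)` lie in the
  -- previous window, whose bound becomes the new boundary forcing.
  have key : ∀ j M : ℕ, M + j = n → ∀ m ∈ Finset.Icc (-(M : ℤ)) M, ∀ t, 0 ≤ t →
      ‖φ m t‖ ≤ K * (2 * ε * ‖B‖ * t) ^ (j + 1) / (j + 1).factorial := by
    have hG : ∀ (j : ℕ) (t : ℝ), HasDerivAt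
        (fun t : ℝ => K * (2 * ε * ‖B‖ * t) ^ (j + 1) / (j + 1).factorial)
        (2 * ε * ‖B‖ * (K * (2 * ε * ‖B‖ * t) ^ j / j.factorial)) t := by
      intro j t
      have h := ((((hasDerivAt_id t).const_mul (2 * ε * ‖B‖)).pow (j + 1)).const_mul
        K).div_const ((j + 1).factorial : ℝ)
      refine h.congr_deriv ?_
      have : (j.factorial : ℝ) ≠ 0 := by positivity
      rw [Nat.factorial_succ]
      push_cast
      field_simp
      simp
    intro j
    induction j with
    | zero =>
      rintro M rfl m hm t ht
      exact norm_mode_le_of_boundary_le B hε hφ hA h0 (hG 0) (by simp)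
        (fun t _ => by simpa using hup t) (fun t _ => by simpa using hdown t) hm ht
    | succ j ih =>
      intro M hM m hm t ht
      have hsub : Finset.Icc (-(M : ℤ)) M ⊆ Finset.Icc (-(n : ℤ)) n :=
        Finset.Icc_subset_Icc (by omega) (by omega)
      refine norm_mode_le_of_boundary_le B hε (fun m hm => hφ m (hsub hm))
        (fun m hm => hA m (hsub hm)) (fun m hm => h0 m (hsub hm)) (hG (j + 1)) (by simp)
        (fun t ht => ih (M + 1) (by omega) _ ?_ t ht)
        (fun t ht => ih (M + 1) (by omega) _ ?_ t ht) hm ht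
      · simp only [Finset.mem_Icc]; omega
      · simp only [Finset.mem_Icc]; omega
  exact key n 0 (by simp) 0 (by simp) t ht

end Hilbert

/-! ### Symmetry and dense domain of the Dirac operator -/

theorem diracSymbol_apply_zero (ξ : EuclideanSpace ℝ (Fin 2)) (v : EuclideanSpace ℂ (Fin 2)) :
    Matrix.toEuclideanCLM (𝕜 := ℂ) (diracSymbol ξ) v 0
      = (2 * Real.pi * ξ 0 - 2 * Real.pi * ξ 1 * Complex.I) * v 1 := by
  simp [diracSymbol, pauli1, pauli2, Matrix.mulVec, dotProduct, Matrix.ofLp_toEuclideanCLM]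
  ring_nf
  simp

theorem diracSymbol_apply_one (ξ : EuclideanSpace ℝ (Fin 2)) (v : EuclideanSpace ℂ (Fin 2)) :
    Matrix.toEuclideanCLM (𝕜 := ℂ) (diracSymbol ξ) v 1
      = (2 * Real.pi * ξ 0 + 2 * Real.pi * ξ 1 * Complex.I) * v 0 := by
  simp [diracSymbol, pauli1, pauli2, Matrix.mulVec, dotProduct, Matrix.ofLp_toEuclideanCLM]

theorem im_inner_diracSymbol (ξ : EuclideanSpace ℝ (Fin 2)) (v : EuclideanSpace ℂ (Fin 2)) :
    (inner ℂ v (Matrix.toEuclideanCLM (𝕜 := ℂ) (diracSymbol ξ) v)).im = 0 := by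
  rw [PiLp.inner_apply, Fin.sum_univ_two, diracSymbol_apply_zero, diracSymbol_apply_one]
  simp
  ring

theorem norm_diracSymbol_apply (ξ : EuclideanSpace ℝ (Fin 2)) (v : EuclideanSpace ℂ (Fin 2)) :
    ‖Matrix.toEuclideanCLM (𝕜 := ℂ) (diracSymbol ξ) v‖ = 2 * Real.pi * ‖ξ‖ * ‖v‖ := by
  refine (sq_eq_sq₀ (by positivity) (by positivity)).mp ?_
  rw [mul_pow, mul_pow, EuclideanSpace.norm_sq_eq, EuclideanSpace.norm_sq_eq v,
    EuclideanSpace.norm_sq_eq ξ, Fin.sum_univ_two, Fin.sum_univ_two, Fin.sum_univ_two,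
    diracSymbol_apply_zero, diracSymbol_apply_one]
  simp only [Complex.sq_norm, Complex.normSq_apply, norm_mul, mul_pow]
  simp
  ring

theorem continuous_diracSymbol_apply :
    Continuous fun p : EuclideanSpace ℝ (Fin 2) × EuclideanSpace ℂ (Fin 2) =>
      Matrix.toEuclideanCLM (𝕜 := ℂ) (diracSymbol p.1) p.2 := by
  refine (PiLp.continuous_toLp 2 _).comp (continuous_pi fun i => ?_)
  fin_cases i <;> simp [diracSymbol, pauli1, pauli2, dotProduct] <;> fun_prop

theorem mem_diracGraph_iff {ψ φ : ElectronSpace} : (ψ, φ) ∈ diracGraph ↔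
    ∀ᵐ ξ ∂(volume : Measure (EuclideanSpace ℝ (Fin 2))), (𝓕 φ : ElectronSpace) ξ
      = Matrix.toEuclideanCLM (𝕜 := ℂ) (diracSymbol ξ) ((𝓕 ψ : ElectronSpace) ξ) :=
  Iff.rfl

/-- `D · σ` is symmetric. -/
theorem im_inner_diracOperator (ψ : diracOperator.domain) :
    (inner ℂ (ψ : ElectronSpace) (diracOperator ψ)).im = 0 := by
  have h : ((ψ : ElectronSpace), diracOperator ψ) ∈ diracGraph := by
    rw [← diracOperator_graph]
    exact diracOperator.mem_graph ψ
  rw [← Lp.inner_fourier_eq, L2.inner_def]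
  have hint := L2.integrable_inner (𝕜 := ℂ) (𝓕 (ψ : ElectronSpace) : ElectronSpace)
    (𝓕 (diracOperator ψ) : ElectronSpace)
  rw [← RCLike.im_eq_complex_im, ← integral_im hint]
  refine integral_eq_zero_of_ae ?_
  filter_upwards [mem_diracGraph_iff.mp h] with ξ hξ
  rw [hξ]
  exact im_inner_diracSymbol ξ _

theorem MeasureTheory.AEStronglyMeasurable.diracSymbol_apply
    {w : EuclideanSpace ℝ (Fin 2) → EuclideanSpace ℂ (Fin 2)} (hw : AEStronglyMeasurable w) :
    AEStronglyMeasurable fun ξ => Matrix.toEuclideanCLM (𝕜 := ℂ) (diracSymbol ξ) (w ξ) := by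
  have h : AEStronglyMeasurable (fun ξ : EuclideanSpace ℝ (Fin 2) => (ξ, w ξ)) volume :=
    continuous_id.aestronglyMeasurable.prodMk hw
  have hF := continuous_diracSymbol_apply
  obtain ⟨F, hFe⟩ : ∃ F : EuclideanSpace ℝ (Fin 2) × EuclideanSpace ℂ (Fin 2) →
    EuclideanSpace ℂ (Fin 2), ∀ p, F p = Matrix.toEuclideanCLM (𝕜 := ℂ) (diracSymbol p.1) p.2 :=
    ⟨_, fun _ => rfl⟩
  simp only [← hFe] at hF
  have hFw : AEStronglyMeasurable (fun ξ => F (ξ, w ξ)) volume := hF.comp_aestronglyMeasurable h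
  simpa only [hFe] using hFw

theorem memLp_inv_one_add_norm_smul {u : EuclideanSpace ℝ (Fin 2) → EuclideanSpace ℂ (Fin 2)}
    (hu : MemLp u 2 volume) : MemLp (fun ξ => ((1 + ‖ξ‖)⁻¹ : ℝ) • u ξ) 2 volume := by
  have hc : Continuous fun ξ : EuclideanSpace ℝ (Fin 2) => (1 + ‖ξ‖)⁻¹ :=
    Continuous.inv₀ (by fun_prop) fun ξ => by positivity
  have hs : AEStronglyMeasurable (fun ξ => ((1 + ‖ξ‖)⁻¹ : ℝ) • u ξ) volume :=
    hc.aestronglyMeasurable.smul hu.1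
  refine hu.of_le_mul (c := 1) hs (Filter.Eventually.of_forall fun ξ => ?_)
  rw [norm_smul, Real.norm_of_nonneg (by positivity)]
  gcongr
  exact inv_le_one_of_one_le₀ (by linarith [norm_nonneg ξ])

/-- The symbol grows like `2π‖ξ‖`, so one factor `(1 + ‖ξ‖)⁻¹` compensates it. This puts the
regularized function in the operator domain. -/
theorem memLp_diracSymbol_inv_one_add_norm_smul
    {u : EuclideanSpace ℝ (Fin 2) → EuclideanSpace ℂ (Fin 2)} (hu : MemLp u 2 volume) :
    MemLp (fun ξ => Matrix.toEuclideanCLM (𝕜 := ℂ) (diracSymbol ξ) (((1 + ‖ξ‖)⁻¹ : ℝ) • u ξ))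
      2 volume := by
  refine hu.of_le_mul (c := 2 * Real.pi)
    (memLp_inv_one_add_norm_smul hu).1.diracSymbol_apply (Filter.Eventually.of_forall fun ξ => ?_)
  rw [norm_diracSymbol_apply, norm_smul, Real.norm_of_nonneg (by positivity), mul_assoc,
    ← mul_assoc ‖ξ‖]
  refine mul_le_mul_of_nonneg_left (mul_le_of_le_one_left (norm_nonneg _) ?_) (by positivity)
  rw [← div_eq_mul_inv, div_le_one (by positivity)]
  linarith

/-- `D · σ` is densely defined. -/
theorem dense_diracOperator_domain : Dense (diracOperator.domain : Set ElectronSpace) := by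
  rw [Submodule.dense_iff_topologicalClosure_eq_top, Submodule.topologicalClosure_eq_top_iff,
    Submodule.eq_bot_iff]
  intro χ hχ
  rw [Submodule.mem_orthogonal'] at hχ
  obtain ⟨u, hu⟩ : ∃ u : ElectronSpace, 𝓕 χ = u := ⟨_, rfl⟩
  -- Testing `χ` against the domain vector with transform `(1 + ‖ξ‖)⁻¹ u` gives a weighted `L²` norm
  -- of `u`, which must vanish.
  have hf : MemLp _ _ _ := memLp_inv_one_add_norm_smul (Lp.memLp u)
  have hg : MemLp _ _ _ := memLp_diracSymbol_inv_one_add_norm_smul (Lp.memLp u)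
  have hmem : ((𝓕⁻ (hf.toLp _) : ElectronSpace), (𝓕⁻ (hg.toLp _) : ElectronSpace)) ∈ diracGraph := by
    rw [mem_diracGraph_iff, FourierTransform.fourier_fourierInv_eq,
      FourierTransform.fourier_fourierInv_eq]
    filter_upwards [hf.coeFn_toLp, hg.coeFn_toLp] with ξ h1 h2
    rw [h1, h2]
  have hdom : (𝓕⁻ (hf.toLp _) : ElectronSpace) ∈ diracOperator.domain := by
    rw [← diracOperator_graph] at hmem
    exact LinearPMap.mem_domain_of_mem_graph hmem
  have h0 := hχ _ hdom
  rw [← Lp.inner_fourier_eq, FourierTransform.fourier_fourierInv_eq, hu, L2.inner_def] at h0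
  have hint := L2.integrable_inner (𝕜 := ℂ) u (hf.toLp _)
  have hae : (fun ξ => (inner ℂ (u ξ) (hf.toLp _ ξ)).re) =ᵐ[volume]
      fun ξ => (1 + ‖ξ‖)⁻¹ * ‖u ξ‖ ^ 2 := by
    filter_upwards [hf.coeFn_toLp] with ξ h1
    rw [h1, RCLike.real_smul_eq_coe_smul (K := ℂ), inner_smul_right, inner_self_eq_norm_sq_to_K]
    norm_cast
  have h1 : ∫ ξ, (1 + ‖ξ‖)⁻¹ * ‖u ξ‖ ^ 2 ∂(volume : Measure (EuclideanSpace ℝ (Fin 2))) = 0 := by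
    rw [← integral_congr_ae hae]
    have := integral_re hint
    rw [h0] at this
    simpa using this
  rw [integral_eq_zero_iff_of_nonneg (fun ξ => by positivity)
    ((integrable_congr hae).mp hint.re)] at h1
  have hu0 : u = 0 := by
    refine Lp.ext ?_
    filter_upwards [h1, Lp.coeFn_zero (EuclideanSpace ℂ (Fin 2)) 2
      (volume : Measure (EuclideanSpace ℝ (Fin 2)))] with ξ h2 h3
    rw [h3]
    have hpos : 1 + ‖ξ‖ ≠ 0 := by positivity
    simpa [hpos] using h2
  exact (Lp.fourierTransformₗᵢ _ _).injective
    ((hu.trans hu0).trans (Lp.fourierTransformₗᵢ _ _).map_zero.symm)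

/-! ### The driven Schrödinger equation -/

noncomputable section

/-- The function `f` solves the Schrödinger equation `i ∂_τ f(τ) = H(τ) f(τ)` of the driven
Hamiltonian. -/
def IsDrivenSolution (B : ElectronSpace →L[ℂ] ElectronSpace) (ε : ℝ) (f : ℝ → ElectronSpace) :
    Prop :=
  ∀ τ : ℝ, ∃ h : f τ ∈ diracOperator.domain,
    HasDerivAt f (-Complex.I • (diracOperator ⟨f τ, h⟩
      + (ε : ℂ) • (Complex.exp (-(Complex.I * τ)) • B (f τ)
        + Complex.exp (Complex.I * τ) • ContinuousLinearMap.adjoint B (f τ)))) τ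

variable {B : ElectronSpace →L[ℂ] ElectronSpace} {ε : ℝ}

theorem IsEvolutionOperator.isDrivenSolution {U : ℝ → ElectronSpace →L[ℂ] ElectronSpace}
    (hU : IsEvolutionOperator (drivenHamiltonian B ε) U) {ψ : ElectronSpace}
    (hψ : ψ ∈ diracOperator.domain) : IsDrivenSolution B ε fun τ => U τ ψ :=
  fun τ => hU.2 ψ hψ τ

theorem IsDrivenSolution.sub {f g : ℝ → ElectronSpace} (hf : IsDrivenSolution B ε f)
    (hg : IsDrivenSolution B ε g) : IsDrivenSolution B ε fun τ => f τ - g τ := by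
  intro τ
  obtain ⟨hfd, hf'⟩ := hf τ
  obtain ⟨hgd, hg'⟩ := hg τ
  refine ⟨diracOperator.domain.sub_mem hfd hgd, (hf'.sub hg').congr_deriv ?_⟩
  have h := diracOperator.map_sub ⟨f τ, hfd⟩ ⟨g τ, hgd⟩
  have h' : diracOperator ⟨f τ - g τ, diracOperator.domain.sub_mem hfd hgd⟩
      = diracOperator (⟨f τ, hfd⟩ - ⟨g τ, hgd⟩) := rfl
  rw [h', h, map_sub, map_sub]
  module

theorem IsDrivenSolution.comp_add_two_pi {f : ℝ → ElectronSpace} (hf : IsDrivenSolution B ε f) :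
    IsDrivenSolution B ε fun τ => f (τ + 2 * Real.pi) := by
  intro τ
  obtain ⟨hfd, hf'⟩ := hf (τ + 2 * Real.pi)
  refine ⟨hfd, (hf'.comp_add_const τ (2 * Real.pi)).congr_deriv ?_⟩
  have h1 : Complex.exp (Complex.I * (τ + 2 * Real.pi : ℝ)) = Complex.exp (Complex.I * τ) := by
    rw [← Complex.exp_periodic (Complex.I * τ)]
    push_cast; ring_nf
  have h2 : Complex.exp (-(Complex.I * (τ + 2 * Real.pi : ℝ))) = Complex.exp (-(Complex.I * τ)) := by
    rw [Complex.exp_neg, Complex.exp_neg, h1]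
  rw [h1, h2]

/-- The driven evolution conserves the norm. -/
theorem IsDrivenSolution.norm_eq {f : ℝ → ElectronSpace} (hf : IsDrivenSolution B ε f)
    (s t : ℝ) : ‖f s‖ = ‖f t‖ := by
  choose hfd hf' using hf
  refine norm_eq_of_hasDerivAt_of_re_inner_eq_zero hf' (fun τ => ?_) s t
  rw [re_inner_neg_I_smul, inner_add_right, Complex.add_im,
    im_inner_diracOperator ⟨f τ, hfd τ⟩, inner_smul_right, inner_add_right, inner_smul_right,
    inner_smul_right, ContinuousLinearMap.adjoint_inner_right, ← inner_conj_symm (B (f τ)),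
    Complex.im_ofReal_mul, Complex.add_im, zero_add]
  have h : Complex.exp (Complex.I * τ) * (starRingEnd ℂ) (inner ℂ (f τ) (B (f τ)))
      = (starRingEnd ℂ) (Complex.exp (-(Complex.I * τ)) * inner ℂ (f τ) (B (f τ))) := by
    rw [map_mul, ← Complex.exp_conj]
    simp
  rw [h, Complex.conj_im]
  ring

section Evolution

variable {U : ℝ → ElectronSpace →L[ℂ] ElectronSpace}

/-- It suffices to bound a bounded operator on the domain of `D · σ`. -/
theorem opNorm_le_of_forall_mem_domain {L : ElectronSpace →L[ℂ] ElectronSpace} {C : ℝ}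
    (hC : 0 ≤ C) (h : ∀ ψ ∈ diracOperator.domain, ‖L ψ‖ ≤ C * ‖ψ‖) : ‖L‖ ≤ C := by
  refine L.opNorm_le_bound hC fun ψ => ?_
  have hcl : IsClosed {ψ : ElectronSpace | ‖L ψ‖ ≤ C * ‖ψ‖} :=
    isClosed_le (by fun_prop) (by fun_prop)
  exact hcl.closure_subset_iff.mpr h (dense_diracOperator_domain ψ)

theorem IsEvolutionOperator.norm_apply (hU : IsEvolutionOperator (drivenHamiltonian B ε) U)
    {ψ : ElectronSpace} (hψ : ψ ∈ diracOperator.domain) (τ : ℝ) : ‖U τ ψ‖ = ‖ψ‖ := by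
  simpa [hU.1] using (hU.isDrivenSolution hψ).norm_eq τ 0

theorem IsEvolutionOperator.norm_le_one (hU : IsEvolutionOperator (drivenHamiltonian B ε) U)
    (τ : ℝ) : ‖U τ‖ ≤ 1 :=
  opNorm_le_of_forall_mem_domain zero_le_one fun ψ hψ => by rw [hU.norm_apply hψ, one_mul]

/-- The monodromy relation of the periodically driven evolution. -/
theorem IsEvolutionOperator.add_two_pi (hU : IsEvolutionOperator (drivenHamiltonian B ε) U) (τ : ℝ) :
    U (τ + 2 * Real.pi) = U τ * U (2 * Real.pi) := by
  rw [← sub_eq_zero, ← norm_le_zero_iff]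
  refine opNorm_le_of_forall_mem_domain le_rfl fun ψ hψ => ?_
  -- The shifted trajectory and the one restarted from `U(2π) ψ` are both solutions with the same
  -- value at `0`. Norm conservation applied to their difference identifies them.
  obtain ⟨hd, -⟩ := hU.isDrivenSolution hψ (2 * Real.pi)
  have h := ((hU.isDrivenSolution hψ).comp_add_two_pi.sub (hU.isDrivenSolution hd)).norm_eq τ 0
  simp [hU.1] at h
  simp [h]

theorem IsEvolutionOperator.add_nat_mul_two_pi
    (hU : IsEvolutionOperator (drivenHamiltonian B ε) U) (τ : ℝ) (N : ℕ) :
    U (τ + 2 * Real.pi * N) = U τ * U (2 * Real.pi) ^ N := by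
  induction N with
  | zero => simp
  | succ N ih =>
    rw [pow_succ, ← mul_assoc, ← ih, ← hU.add_two_pi]
    push_cast; ring_nf

end Evolution

/-! ### Modes of the replica group -/

section Replica

variable {S : Finset ℤ} {T : ℝ → ReplicaSpace S →L[ℂ] ReplicaSpace S}

theorem replicaMode_of_mem {m : ℤ} (hm : m ∈ S) (Φ : ReplicaSpace S) :
    replicaMode S m Φ = Φ ⟨m, hm⟩ := by
  simp [replicaMode, hm]

theorem replicaMode_of_notMem {m : ℤ} (hm : m ∉ S) (Φ : ReplicaSpace S) :
    replicaMode S m Φ = 0 := by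
  simp [replicaMode, hm]

/-- A unitary group preserves the domain of its generator and solves the Schrödinger equation. -/
theorem IsUnitaryGroup.hasDerivAt {E : Type*} [NormedAddCommGroup E] [InnerProductSpace ℂ E]
    [CompleteSpace E] {A : E →ₗ.[ℂ] E} {T : ℝ → E →L[ℂ] E} (hT : IsUnitaryGroup A T)
    (x : A.domain) (t : ℝ) :
    ∃ h : T t x ∈ A.domain, HasDerivAt (fun s => T s x) (-Complex.I • A ⟨T t x, h⟩) t := by
  have h0 : HasDerivAt (fun s => T s x) (-Complex.I • A x) 0 :=
    (hT.generator _ _).mp (A.mem_graph x)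
  have h1 : HasDerivAt (fun s => T t (T s x)) (-Complex.I • T t (A x)) 0 := by
    have := ((T t).restrictScalars ℝ).hasFDerivAt.comp_hasDerivAt (0 : ℝ) h0
    simpa [Function.comp_def] using this
  -- Since `T t` commutes with `T s`, the orbit of `T t x` is differentiable at `0`, so the
  -- generator property places `T t x` in the domain.
  have h2 : ((T t x : E), T t (A x)) ∈ A.graph := by
    refine (hT.generator _ _).mpr (h1.congr_of_eventuallyEq (.of_forall fun s => ?_))
    change T s (T t x) = T t (T s x)
    rw [← mul_apply_eq_comp, ← hT.add, add_comm, hT.add, mul_apply_eq_comp]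
  have hd := LinearPMap.mem_domain_of_mem_graph h2
  refine ⟨hd, ?_⟩
  have h3 : A ⟨T t x, hd⟩ = T t (A x) :=
    (LinearPMap.mem_graph_snd_inj A (A.mem_graph ⟨T t x, hd⟩) h2 rfl)
  rw [h3]
  have h4 : HasDerivAt (fun s => T t (T (s - t) x)) (-Complex.I • T t (A x)) t := by
    have h1' : HasDerivAt (fun s => T t (T s x)) (-Complex.I • T t (A x)) (t - t) := by
      rwa [sub_self]
    exact h1'.comp_sub_const t t
  refine h4.congr_of_eventuallyEq (.of_forall fun s => ?_)
  change T s x = T t (T (s - t) x)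
  rw [← mul_apply_eq_comp, ← hT.add, add_sub_cancel]

theorem IsUnitaryGroup.hasDerivAt_replicaMode
    (hT : IsUnitaryGroup (replicaHamiltonian B ε S) T) {Φ : ReplicaSpace S}
    (hΦ : ∀ m : S, Φ m ∈ diracOperator.domain) {m : ℤ} (hm : m ∈ S) (t : ℝ) :
    ∃ h : replicaMode S m (T t Φ) ∈ diracOperator.domain,
      HasDerivAt (fun s => replicaMode S m (T s Φ))
        (-Complex.I • ((m : ℂ) • replicaMode S m (T t Φ)
          + diracOperator ⟨replicaMode S m (T t Φ), h⟩
          + (ε : ℂ) • B (replicaMode S (m + 1) (T t Φ))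
          + (ε : ℂ) • ContinuousLinearMap.adjoint B (replicaMode S (m - 1) (T t Φ)))) t := by
  obtain ⟨hd, h⟩ := IsUnitaryGroup.hasDerivAt hT ⟨Φ, hΦ⟩ t
  have e := replicaMode_of_mem hm (T t Φ)
  have hmem : replicaMode S m (T t Φ) ∈ diracOperator.domain := e ▸ hd ⟨m, hm⟩
  refine ⟨hmem, ?_⟩
  have h1 := ((replicaMode S m).restrictScalars ℝ).hasFDerivAt.comp_hasDerivAt t h
  refine h1.congr_deriv ?_
  rw [ContinuousLinearMap.coe_restrictScalars', map_smul, replicaMode_of_mem hm]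
  congr 1
  have h2 : diracOperator ⟨replicaMode S m (T t Φ), hmem⟩
      = diracOperator ⟨(T t Φ) ⟨m, hm⟩, hd ⟨m, hm⟩⟩ := by congr 1; exact Subtype.ext e
  rw [h2, e]
  rfl

end Replica

end

/-! ### Local error within one period -/

noncomputable section

variable {B : ElectronSpace →L[ℂ] ElectronSpace} {ε : ℝ} {n : ℕ}

/-- Summing the blocks over `k` amounts to starting the group from the same `ψ` in every mode. These
are also the values at time zero of `e^{-imτ} U(τ) ψ`. -/
theorem replicaEvolution_apply (T : ℝ → ReplicaSpace (modeSet n) →L[ℂ] ReplicaSpace (modeSet n))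
    (τ : ℝ) (ψ : ElectronSpace) :
    replicaEvolution T τ ψ = replicaMode (modeSet n) 0 (T τ (WithLp.toLp 2 fun _ => ψ)) := by
  have h0 := replicaMode_of_mem (centralMode n).2 (T τ (WithLp.toLp 2 fun _ => ψ))
  refine Eq.trans ?_ h0.symm
  have h : (WithLp.toLp 2 fun _ => ψ : ReplicaSpace (modeSet n))
      = ∑ k : modeSet n, WithLp.toLp 2 (Pi.single k ψ) := by
    ext1 m
    simp [Finset.sum_apply, Pi.single_apply]
  rw [h, map_sum]
  simp only [replicaEvolution, _root_.sum_apply, WithLp.ofLp_sum, Finset.sum_apply]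
  rfl

/-- The function `τ ↦ e^{-imτ} f(τ)` is the `m`-th mode of a solution of the replica model with
all modes retained. -/
theorem IsDrivenSolution.hasDerivAt_mode {f : ℝ → ElectronSpace} (hf : IsDrivenSolution B ε f)
    (m : ℤ) (t : ℝ) :
    ∃ h : Complex.exp (-(Complex.I * m * t)) • f t ∈ diracOperator.domain,
      HasDerivAt (fun s : ℝ => Complex.exp (-(Complex.I * m * s)) • f s)
        (-Complex.I • ((m : ℂ) • (Complex.exp (-(Complex.I * m * t)) • f t)
          + diracOperator ⟨Complex.exp (-(Complex.I * m * t)) • f t, h⟩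
          + (ε : ℂ) • B (Complex.exp (-(Complex.I * (m + 1 : ℤ) * t)) • f t)
          + (ε : ℂ) • ContinuousLinearMap.adjoint B
            (Complex.exp (-(Complex.I * (m - 1 : ℤ) * t)) • f t))) t := by
  obtain ⟨hd, h⟩ := hf t
  refine ⟨diracOperator.domain.smul_mem _ hd, ?_⟩
  have he : HasDerivAt (fun s : ℝ => Complex.exp (-(Complex.I * m * s)))
      (Complex.exp (-(Complex.I * m * t)) * (-(Complex.I * m))) t := by
    have h1 : HasDerivAt (fun s : ℝ => -(Complex.I * m * s)) (-(Complex.I * m)) t := by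
      simpa [Function.comp_def] using
        ((Complex.ofRealCLM.hasDerivAt (x := t)).const_mul (-(Complex.I * m)))
    exact h1.cexp
  refine (he.smul h).congr_deriv ?_
  have h1 : Complex.exp (-(Complex.I * (m + 1 : ℤ) * t))
      = Complex.exp (-(Complex.I * m * t)) * Complex.exp (-(Complex.I * t)) := by
    rw [← Complex.exp_add]; push_cast; ring_nf
  have h2 : Complex.exp (-(Complex.I * (m - 1 : ℤ) * t))
      = Complex.exp (-(Complex.I * m * t)) * Complex.exp (Complex.I * t) := by
    rw [← Complex.exp_add]; push_cast; ring_nf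
  have h3 : diracOperator ⟨Complex.exp (-(Complex.I * m * t)) • f t,
      diracOperator.domain.smul_mem _ hd⟩
      = Complex.exp (-(Complex.I * m * t)) • diracOperator ⟨f t, hd⟩ :=
    diracOperator.map_smul _ ⟨f t, hd⟩
  rw [h1, h2, h3]
  simp only [map_smul, mul_smul]
  module

/-- The local error of the replica model. -/
theorem norm_sub_replicaEvolution_le {U : ℝ → ElectronSpace →L[ℂ] ElectronSpace}
    (hU : IsEvolutionOperator (drivenHamiltonian B ε) U)
    {T : ℝ → ReplicaSpace (modeSet n) →L[ℂ] ReplicaSpace (modeSet n)}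
    (hT : IsUnitaryGroup (replicaHamiltonian B ε (modeSet n)) T) (hε : 0 ≤ ε) {τ : ℝ}
    (hτ : 0 ≤ τ) :
    ‖U τ - replicaEvolution T τ‖ ≤ (2 * ε * ‖B‖ * τ) ^ (n + 1) / (n + 1).factorial := by
  refine opNorm_le_of_forall_mem_domain (by positivity) fun ψ hψ => ?_
  set Φ : ReplicaSpace (modeSet n) := WithLp.toLp 2 fun _ => ψ with hΦ
  have hsol := hU.isDrivenSolution hψ
  set φ : ℤ → ℝ → ElectronSpace := fun m t =>
    replicaMode (modeSet n) m (T t Φ) - Complex.exp (-(Complex.I * m * t)) • U t ψ with hφ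
  choose hRd hR using fun (m : ℤ) (hm : m ∈ modeSet n) (t : ℝ) =>
    hT.hasDerivAt_replicaMode (Φ := Φ) (fun _ => hψ) hm t
  choose hMd hM using fun (m : ℤ) (t : ℝ) => hsol.hasDerivAt_mode m t
  have hdom : ∀ m ∈ modeSet n, ∀ t, φ m t ∈ diracOperator.domain := fun m hm t =>
    diracOperator.domain.sub_mem (hRd m hm t) (hMd m t)
  -- `A` is the diagonal part `m + D · σ`. Domain membership is known only for retained modes, so it
  -- is set to zero elsewhere.
  obtain ⟨A, hA⟩ : ∃ A : ℤ → ℝ → ElectronSpace, ∀ m (hm : m ∈ modeSet n) t,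
      A m t = (m : ℂ) • φ m t + diracOperator ⟨φ m t, hdom m hm t⟩ := by
    classical
    exact ⟨fun m t => if hm : m ∈ modeSet n then
      (m : ℂ) • φ m t + diracOperator ⟨φ m t, hdom m hm t⟩ else 0,
      fun m hm t => dif_pos hm⟩
  have hout : ∀ m ∉ modeSet n, ∀ t, ‖φ m t‖ ≤ ‖ψ‖ := by
    intro m hm t
    have he : ‖Complex.exp (-(Complex.I * m * t))‖ = 1 := by
      rw [Complex.norm_exp]; simp
    rw [hφ]
    simp only
    rw [replicaMode_of_notMem hm, zero_sub, norm_neg, norm_smul, he, one_mul, hU.norm_apply hψ]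
  have key := norm_central_mode_le B hε (φ := φ) (A := A) (n := n) (K := ‖ψ‖) ?_ ?_ ?_
    (hout _ (by simp [modeSet])) (hout _ (by simp [modeSet])) hτ
  · have e : φ 0 τ = -((U τ - replicaEvolution T τ) ψ) := by
      simp [hφ, replicaEvolution_apply, hΦ]
    rw [e, norm_neg] at key
    refine key.trans_eq ?_
    ring
  · intro m hm t
    refine ((hR m hm t).sub (hM m t)).congr_deriv ?_
    have h := diracOperator.map_sub ⟨_, hRd m hm t⟩ ⟨_, hMd m t⟩
    have h' : diracOperator ⟨φ m t, hdom m hm t⟩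
      = diracOperator (⟨_, hRd m hm t⟩ - ⟨_, hMd m t⟩) := rfl
    rw [hA m hm, h', h]
    simp only [hφ, map_sub]
    module
  · intro m hm t
    rw [hA m hm, inner_add_right, Complex.add_im, im_inner_diracOperator ⟨φ m t, hdom m hm t⟩,
      inner_smul_right, inner_self_eq_norm_sq_to_K, add_zero]
    refine Eq.trans ?_ (Complex.ofReal_im (m * ‖φ m t‖ ^ 2))
    push_cast
    rfl
  · intro m hm
    simp only [hφ]
    have h := replicaMode_of_mem (S := modeSet n) hm (T 0 Φ)
    rw [h, hT.zero, hU.1]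
    simp [hΦ]

/-! ### Accumulation of the error over many periods -/

theorem norm_pow_le_of_norm_one_le {R : Type*} [NormedRing R] (h1 : ‖(1 : R)‖ ≤ 1) {b : R}
    {c : ℝ} (hb : ‖b‖ ≤ c) (N : ℕ) : ‖b ^ N‖ ≤ c ^ N := by
  have hc := (norm_nonneg _).trans hb
  induction N with
  | zero => simpa using h1
  | succ N ih =>
    rw [pow_succ, pow_succ]
    exact (norm_mul_le _ _).trans (mul_le_mul ih hb (norm_nonneg _) (by positivity))

theorem norm_pow_sub_pow_le {R : Type*} [NormedRing R] (h1 : ‖(1 : R)‖ ≤ 1) {a b : R} {δ : ℝ}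
    (ha : ‖a‖ ≤ 1) (hab : ‖a - b‖ ≤ δ) (N : ℕ) : ‖a ^ N - b ^ N‖ ≤ N * δ * (1 + δ) ^ N := by
  have hδ := (norm_nonneg _).trans hab
  have hb : ‖b‖ ≤ 1 + δ := by
    have := norm_sub_norm_le b a
    rw [norm_sub_rev] at this
    linarith
  induction N with
  | zero => simp
  | succ N ih =>
    have e : a ^ (N + 1) - b ^ (N + 1) = a * (a ^ N - b ^ N) + (a - b) * b ^ N := by
      rw [pow_succ', pow_succ']; noncomm_ring
    rw [e]
    have h1' : ‖a * (a ^ N - b ^ N)‖ ≤ N * δ * (1 + δ) ^ N :=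
      (norm_mul_le _ _).trans ((mul_le_of_le_one_left (norm_nonneg _) ha).trans ih)
    have h2 : ‖(a - b) * b ^ N‖ ≤ δ * (1 + δ) ^ N :=
      (norm_mul_le _ _).trans (mul_le_mul hab (norm_pow_le_of_norm_one_le h1 hb N)
        (norm_nonneg _) hδ)
    have h3 : (1 + δ) ^ N ≤ (1 + δ) ^ (N + 1) := pow_le_pow_right₀ (by linarith) (by omega)
    calc _ ≤ N * δ * (1 + δ) ^ N + δ * (1 + δ) ^ N := (norm_add_le _ _).trans (add_le_add h1' h2)
      _ = (N + 1) * δ * (1 + δ) ^ N := by ring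
      _ ≤ (N + 1) * δ * (1 + δ) ^ (N + 1) := by gcongr
      _ = _ := by push_cast; ring

theorem replicaConstant_nonneg (n : ℕ) {b : ℝ} (hb : 0 ≤ b) : 0 ≤ replicaConstant n b := by
  unfold replicaConstant; positivity

theorem replicaConstant_mono (n : ℕ) {b c : ℝ} (hb : 0 ≤ b) (hbc : b ≤ c) :
    replicaConstant n b ≤ replicaConstant n c := by
  unfold replicaConstant; gcongr

/-- The local error over a time `τ` of at most a period, in terms of `c_n`. -/
theorem local_error_le (n : ℕ) {b ε τ : ℝ} (hb : 0 ≤ b) (hε : 0 ≤ ε) (hτ : 0 ≤ τ)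
    (hτ' : τ ≤ 2 * Real.pi) : (2 * ε * b * τ) ^ (n + 1) / (n + 1).factorial
      ≤ replicaConstant n b * ε ^ (n + 1) * τ / 2 := by
  have hpi := Real.pi_pos
  -- Trading the power for a linear bound makes local errors additive in time.
  have h1 : (τ / (2 * Real.pi)) ^ (n + 1) ≤ τ / (2 * Real.pi) :=
    pow_le_of_le_one (by positivity) ((div_le_one (by positivity)).mpr hτ') (by omega)
  calc (2 * ε * b * τ) ^ (n + 1) / (n + 1).factorial
      = (4 * Real.pi * b * ε) ^ (n + 1) / (n + 1).factorial * (τ / (2 * Real.pi)) ^ (n + 1) := by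
        rw [div_mul_eq_mul_div, ← mul_pow]; congr 2; field_simp; ring
    _ ≤ (4 * Real.pi * b * ε) ^ (n + 1) / (n + 1).factorial * (τ / (2 * Real.pi)) := by gcongr
    _ = _ := by unfold replicaConstant; rw [mul_pow _ ε]; field_simp

/-- The global error of the replica model. -/
theorem norm_sub_periodicExtension_le {U : ℝ → ElectronSpace →L[ℂ] ElectronSpace}
    (hU : IsEvolutionOperator (drivenHamiltonian B ε) U)
    {T : ℝ → ReplicaSpace (modeSet n) →L[ℂ] ReplicaSpace (modeSet n)}
    (hT : IsUnitaryGroup (replicaHamiltonian B ε (modeSet n)) T) (hε : 0 ≤ ε) {τ : ℝ}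
    (hτ : 0 ≤ τ) :
    ‖U τ - periodicExtension (replicaEvolution T) τ‖
      ≤ replicaConstant n ‖B‖ * (τ + 1) * ε ^ (n + 1)
        * Real.exp (replicaConstant n ‖B‖ * τ * ε ^ (n + 1)) := by
  have hpi := Real.pi_pos
  set N := ⌊τ / (2 * Real.pi)⌋₊ with hN
  set σ := τ - 2 * Real.pi * N with hσ
  have hσ0 : 0 ≤ σ := by
    have := Nat.floor_le (show 0 ≤ τ / (2 * Real.pi) by positivity)
    rw [le_div_iff₀ (by positivity)] at this
    rw [hσ]; linarith
  have hσ1 : σ ≤ 2 * Real.pi := by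
    have := (Nat.lt_floor_add_one (τ / (2 * Real.pi))).le
    rw [div_le_iff₀ (by positivity)] at this
    rw [hσ]; linarith
  set V := replicaEvolution T
  set x := replicaConstant n ‖B‖ * ε ^ (n + 1) with hx
  have hx0 : 0 ≤ x := mul_nonneg (replicaConstant_nonneg n (norm_nonneg _)) (by positivity)
  -- This is the local bound `x τ / 2` at the full period `τ = 2π`.
  set δ := x * Real.pi with hδ
  have hδ0 : 0 ≤ δ := by positivity
  have h1 : ‖U σ - V σ‖ ≤ x * σ / 2 := (norm_sub_replicaEvolution_le hU hT hε hσ0).trans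
    (local_error_le n (norm_nonneg _) hε hσ0 hσ1)
  have h2 : ‖U (2 * Real.pi) - V (2 * Real.pi)‖ ≤ δ :=
    (norm_sub_replicaEvolution_le hU hT hε (by positivity)).trans
      ((local_error_le n (norm_nonneg _) hε (by positivity) le_rfl).trans_eq (by rw [hδ, hx]; ring))
  have hV : ‖V (2 * Real.pi)‖ ≤ 1 + δ := by
    have := norm_sub_norm_le (V (2 * Real.pi)) (U (2 * Real.pi))
    rw [norm_sub_rev] at this
    linarith [hU.norm_le_one (2 * Real.pi)]
  have hVN : ‖V (2 * Real.pi) ^ N‖ ≤ (1 + δ) ^ N :=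
    norm_pow_le_of_norm_one_le ContinuousLinearMap.norm_id_le hV N
  have hUτ : U τ = U σ * U (2 * Real.pi) ^ N := by
    rw [← hU.add_nat_mul_two_pi]; congr 1; rw [hσ]; ring
  have hsplit : U τ - periodicExtension V τ
      = U σ * (U (2 * Real.pi) ^ N - V (2 * Real.pi) ^ N)
        + (U σ - V σ) * V (2 * Real.pi) ^ N := by
    rw [hUτ, mul_sub, sub_mul, sub_add_sub_cancel]; rfl
  have hexp : (1 + δ) ^ N ≤ Real.exp (x * τ) := by
    calc (1 + δ) ^ N ≤ Real.exp δ ^ N := by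
          gcongr; linarith [Real.add_one_le_exp δ]
      _ = Real.exp (N * δ) := (Real.exp_nat_mul _ _).symm
      _ ≤ Real.exp (x * τ) := by
          refine Real.exp_le_exp.mpr ?_
          have : N * δ = x * (Real.pi * N) := by rw [hδ]; ring
          rw [this]
          refine mul_le_mul_of_nonneg_left ?_ hx0
          have : 0 ≤ Real.pi * N := by positivity
          linarith
  have h3 : ‖U σ * (U (2 * Real.pi) ^ N - V (2 * Real.pi) ^ N)‖ ≤ N * δ * (1 + δ) ^ N :=
    (norm_mul_le _ _).trans ((mul_le_of_le_one_left (norm_nonneg _) (hU.norm_le_one σ)).trans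
      (norm_pow_sub_pow_le ContinuousLinearMap.norm_id_le (hU.norm_le_one _) h2 N))
  have h4 : ‖(U σ - V σ) * V (2 * Real.pi) ^ N‖ ≤ x * σ / 2 * (1 + δ) ^ N :=
    (norm_mul_le _ _).trans (mul_le_mul h1 hVN (norm_nonneg _) (by positivity))
  calc ‖U τ - periodicExtension V τ‖
      ≤ N * δ * (1 + δ) ^ N + x * σ / 2 * (1 + δ) ^ N := by
        rw [hsplit]; exact (norm_add_le _ _).trans (add_le_add h3 h4)
    -- The `N` full periods and the remainder recombine through `2πN + σ = τ`.
    _ = x * (τ / 2) * (1 + δ) ^ N := by rw [hδ, hσ]; ring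
    _ ≤ x * (τ + 1) * Real.exp (x * τ) := by gcongr; linarith
    _ = _ := by rw [hx]; ring_nf

/-- The error bound is small on time scales `ε^{-(n+1)}`. -/
theorem exists_time_scale (n : ℕ) (b : ℝ) {η : ℝ} (hη : 0 < η) : ∃ κ : ℝ, 0 < κ ∧ ∃ ε₀ : ℝ,
    0 < ε₀ ∧ ∀ c ε τ : ℝ, 0 ≤ c → c ≤ b → 0 < ε → ε ≤ ε₀ → 0 ≤ τ → τ ≤ κ / ε ^ (n + 1) →
      replicaConstant n c * (τ + 1) * ε ^ (n + 1)
        * Real.exp (replicaConstant n c * τ * ε ^ (n + 1)) ≤ η := by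
  rcases lt_or_ge b 0 with hb | hb
  · exact ⟨1, one_pos, 1, one_pos, fun c _ _ hc hcb => by linarith⟩
  set C := replicaConstant n b
  have hC : 0 ≤ C := replicaConstant_nonneg n hb
  have hden : 0 < 2 * C * Real.exp C + 1 := by positivity
  -- With `τ ε^(n+1)` and `ε^(n+1)` both at most `κ ≤ 1`, the error is at most `2κ C e^C`. The `+ 1`
  -- covers `C = 0`, and the same `κ` serves as `ε₀`.
  set κ := min 1 (η / (2 * C * Real.exp C + 1)) with hκ
  have hκ0 : 0 < κ := lt_min one_pos (by positivity)
  have hκ1 : κ ≤ 1 := min_le_left _ _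
  refine ⟨κ, hκ0, κ, hκ0, fun c ε τ hc hcb hε hεκ hτ hτκ => ?_⟩
  have hcC : replicaConstant n c ≤ C := replicaConstant_mono n hc hcb
  have hτε : τ * ε ^ (n + 1) ≤ κ := (le_div_iff₀ (by positivity)).mp hτκ
  have hεn : ε ^ (n + 1) ≤ κ :=
    (pow_le_of_le_one hε.le (hεκ.trans hκ1) (by omega)).trans hεκ
  calc replicaConstant n c * (τ + 1) * ε ^ (n + 1)
        * Real.exp (replicaConstant n c * τ * ε ^ (n + 1))
      = replicaConstant n c * (τ * ε ^ (n + 1) + ε ^ (n + 1))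
        * Real.exp (replicaConstant n c * (τ * ε ^ (n + 1))) := by ring_nf
    _ ≤ C * (κ + κ) * Real.exp (C * 1) := by
        gcongr
        exact hτε.trans hκ1
    _ = κ * (2 * C * Real.exp C) := by rw [mul_one]; ring
    _ ≤ κ * (2 * C * Real.exp C + 1) := by gcongr; linarith
    _ ≤ η := (le_div_iff₀ hden).mp (min_le_right _ _)

end

theorem theorem2p2 (n : ℕ) :
    (∀ (B : ElectronSpace →L[ℂ] ElectronSpace) (ε : ℝ), 0 < ε →
      ∀ U : ℝ → ElectronSpace →L[ℂ] ElectronSpace,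
        IsEvolutionOperator (drivenHamiltonian B ε) U →
      ∀ T : ℝ → ReplicaSpace (modeSet n) →L[ℂ] ReplicaSpace (modeSet n),
        IsUnitaryGroup (replicaHamiltonian B ε (modeSet n)) T →
      ∀ τ : ℝ, 0 ≤ τ →
        ‖U τ - periodicExtension (replicaEvolution T) τ‖
          ≤ replicaConstant n ‖B‖ * (τ + 1) * ε ^ (n + 1)
            * Real.exp (replicaConstant n ‖B‖ * τ * ε ^ (n + 1))) ∧
    (∀ b η : ℝ, 0 < η → ∃ κ : ℝ, 0 < κ ∧ ∃ ε₀ : ℝ, 0 < ε₀ ∧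
      ∀ (B : ElectronSpace →L[ℂ] ElectronSpace) (ε : ℝ), ‖B‖ ≤ b → 0 < ε → ε ≤ ε₀ →
      ∀ U : ℝ → ElectronSpace →L[ℂ] ElectronSpace,
        IsEvolutionOperator (drivenHamiltonian B ε) U →
      ∀ T : ℝ → ReplicaSpace (modeSet n) →L[ℂ] ReplicaSpace (modeSet n),
        IsUnitaryGroup (replicaHamiltonian B ε (modeSet n)) T →
      ∀ τ : ℝ, 0 ≤ τ → τ ≤ κ / ε ^ (n + 1) →
        ‖U τ - periodicExtension (replicaEvolution T) τ‖ ≤ η) :=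
  ⟨fun _ _ hε _ hU _ hT _ hτ => norm_sub_periodicExtension_le hU hT hε.le hτ, fun b _ hη => by
    obtain ⟨κ, hκ, ε₀, hε₀, h⟩ := exists_time_scale n b hη
    exact ⟨κ, hκ, ε₀, hε₀, fun B ε hB hε hεε U hU T hT τ hτ hτκ =>
      (norm_sub_periodicExtension_le hU hT hε.le hτ).trans
        (h ‖B‖ ε τ (norm_nonneg _) hB hε hεε hτ hτκ)⟩⟩
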